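/- Let $(\Omega,\mathcal F)$ be a measurable space with a measurable flow $(\theta_s)_{s\in\mathbb R^d}$ (i.e. $(\omega,s)\mapsto\theta_s\omega$ is measurable, $\theta_0=\mathrm{id}$, $\theta_s\circ\theta_t=\theta_{s+t}$), and let $\mathbb P$ be a probability measure on $\Omega$ that is invariant under every $\theta_s$. Let $\Phi,\Psi$ be stationary random measures on $\mathbb R^d$, that is, measurable maps from $\Omega$ to the locally finite Borel measures on $\mathbb R^d$ with $\Phi_{\theta_s\omega}(B)=\Phi_\omega(B+s)$ and $\Psi_{\theta_s\omega}(B)=\Psi_\omega(B+s)$ for all $s$, $\omega$ and Borel $B$. Assume that $\Phi$ and $\Psi$ are almost surely non-zero and have finite intensities, i.e. $\mathbb E[\Phi(B)]=\lambda_\Phi\,\mathcal L_d(B)$ and $\mathbb E[\Psi(B)]=\lambda_\Psi\,\mathcal L_d(B)$ for all Borel $B$, with $\lambda_\Phi,\lambda_\Psi<\infty$. For locally finite measures $\varphi,\psi$ on $\mathbb R^d$, a constrained density is a measurable function $f:\mathbb R^d\times\mathbb R^d\to[0,1]$ with $\int f(x,\xi)\,\psi(d\xi)\le 1$ for all $x$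 and $\int f(x,\xi)\,\varphi(dx)\le 1$ for all $\xi$. A point $x_0$ desires $\xi_0$ if $f(x_0,\xi_0)<1$ and either $\int f(x_0,\xi)\,\psi(d\xi)\neq1$ or there is $\xi_1\in\mathbb R^d$ with $|x_0-\xi_1|>|x_0-\xi_0|$ and $f(x_0,\xi_1)>0$; symmetrically, $\xi_0$ desires $x_0$ if $f(x_0,\xi_0)<1$ and either $\int f(x,\xi_0)\,\varphi(dx)\ne1$ or there is $x_1\in\mathbb R^d$ with $|x_1-\xi_0|>|x_0-\xi_0|$ and $f(x_1,\xi_0)>0$. The density $f$ is stable if there is no $(x_0,\xi_0)\in\mathbb R^d\times\mathbb R^d$ such that $x_0$ and $\xi_0$ desire each other. The points of the support of $\varphi$ (resp. $\psi$) are called sites (resp. centers); the territory of a site $x$ is $\{\xi\in\mathbb R^d: f(x,\xi)>0\}$ and the territory of a center $\xi$ is $\{x\in\mathbb R^d: f(x,\xi)>0\}$ (the same notation is used for arbitrary points of $\mathbb R^d$). Let $F=F_\omega(x,\xi)$ be jointly measurable in $(\omega,x,\xi)$ and flow-adapted, i.e. $F_{\theta_s\omega}(x,\xi)=F_\omega(x+s,\xi+s)$,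 and suppose that almost surely $F_\omega$ is a stable constrained density for $(\Phi_\omega,\Psi_\omega)$. Then, almost surely: (i) $\Phi_\omega$-almost all sites and $\Psi_\omega$-almost all centers have bounded territories; (ii) for every bounded set $B\subset\mathbb R^d$, the union $\bigcup_{x\in B}\{\xi: F_\omega(x,\xi)>0\}$ has finite $\Psi_\omega$-measure and the union $\bigcup_{\xi\in B}\{x: F_\omega(x,\xi)>0\}$ has finite $\Phi_\omega$-measure (outer measure, when the set is not measurable). In particular, the union of the territories of the sites (resp. centers) in a bounded set has finite $\Psi_\omega$-measure (resp. finite $\Phi_\omega$-measure). -/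

import Mathlib

open MeasureTheory
open scoped ENNReal NNReal

namespace StableDensity

/-- `ℝ^d` with its Euclidean distance, Borel `σ`-field and Lebesgue measure. -/
abbrev Space (d : ℕ) : Type := EuclideanSpace ℝ (Fin d)

section Random

variable {d : ℕ} {Ω : Type*} [MeasurableSpace Ω]

/-- A measurable flow `(θ_s)`, `s ∈ ℝ^d`, on the measurable space `Ω`. -/
structure IsMeasurableFlow (θ : Space d → Ω → Ω) : Prop where
  measurable : Measurable fun p : Ω × Space d => θ p.2 p.1
  zero : ∀ ω, θ 0 ω = ω
  comp : ∀ s t ω, θ s (θ t ω) = θ (s + t) ω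

/-- The measure `P` on `Ω` is invariant under every `θ_s`. -/
def IsStationary (θ : Space d → Ω → Ω) (P : Measure Ω) : Prop :=
  ∀ s, MeasurePreserving (θ s) P P

/-- The shift `(θ_s φ)(B) = φ(B + s)` of a measure on `ℝ^d`. -/
noncomputable def shiftMeasure (s : Space d) (φ : Measure (Space d)) : Measure (Space d) :=
  φ.map (fun y => y - s)

/-- `(P, Φ)` is a stationary random measure with respect to the flow `θ`: `P` is stationary, and
`Φ` is a measurable flow-adapted map into the locally finite measures on `ℝ^d` (the `σ`-field on
measures being the one generated by the evaluations at Borel sets). -/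
structure IsStationaryRandomMeasure (θ : Space d → Ω → Ω) (P : Measure Ω)
    (Φ : Ω → Measure (Space d)) : Prop where
  stationary : IsStationary θ P
  measurable : Measurable Φ
  locallyFinite : ∀ ω, IsLocallyFiniteMeasure (Φ ω)
  flowAdapted : ∀ s ω, Φ (θ s ω) = shiftMeasure s (Φ ω)

/-- `lam` is the intensity of `(P, Φ)`: `E[Φ(B)] = lam * Leb(B)` for all Borel sets `B`. -/
def HasIntensity (P : Measure Ω) (Φ : Ω → Measure (Space d)) (lam : ℝ≥0∞) : Prop :=
  ∀ B : Set (Space d), MeasurableSet B → ∫⁻ ω, Φ ω B ∂P = lam * volume B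

/-- A (jointly) measurable random function of a site and a center such that
`F_{θ_s ω}(x, ξ) = F_ω(x + s, ξ + s)`. -/
structure IsFlowAdaptedFunction (θ : Space d → Ω → Ω) (F : Ω → Space d → Space d → ℝ) : Prop where
  measurable : Measurable fun p : Ω × Space d × Space d => F p.1 p.2.1 p.2.2
  flowAdapted : ∀ s ω x ξ, F (θ s ω) x ξ = F ω (x + s) (ξ + s)

end Random

section Deterministic

variable {d : ℕ}

/-- `f` is a constrained density for `(φ, ψ)`: a measurable function with values in `[0, 1]`
whose two marginal integrals are at most `1` at every point. -/
structure IsConstrainedDensity (φ ψ : Measure (Space d)) (f : Space d → Space d → ℝ) : Prop where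
  measurable : Measurable fun p : Space d × Space d => f p.1 p.2
  nonneg : ∀ x ξ, 0 ≤ f x ξ
  le_one : ∀ x ξ, f x ξ ≤ 1
  site_le : ∀ x, ∫⁻ ξ, ENNReal.ofReal (f x ξ) ∂ψ ≤ 1
  center_le : ∀ ξ, ∫⁻ x, ENNReal.ofReal (f x ξ) ∂φ ≤ 1

/-- The site `x` is `f`-exhausted. -/
def Exhausted (ψ : Measure (Space d)) (f : Space d → Space d → ℝ) (x : Space d) : Prop :=
  ∫⁻ ξ, ENNReal.ofReal (f x ξ) ∂ψ = 1

/-- The center `ξ` is `f`-sated. -/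
def Sated (φ : Measure (Space d)) (f : Space d → Space d → ℝ) (ξ : Space d) : Prop :=
  ∫⁻ x, ENNReal.ofReal (f x ξ) ∂φ = 1

/-- The site `x₀` `f`-desires the center `ξ₀`. -/
def SiteDesires (ψ : Measure (Space d)) (f : Space d → Space d → ℝ) (x₀ ξ₀ : Space d) : Prop :=
  f x₀ ξ₀ < 1 ∧ (¬ Exhausted ψ f x₀ ∨ ∃ ξ₁, dist x₀ ξ₀ < dist x₀ ξ₁ ∧ 0 < f x₀ ξ₁)

/-- The center `ξ₀` `f`-desires the site `x₀`. -/
def CenterDesires (φ : Measure (Space d)) (f : Space d → Space d → ℝ) (x₀ ξ₀ : Space d) : Prop :=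
  f x₀ ξ₀ < 1 ∧ (¬ Sated φ f ξ₀ ∨ ∃ x₁, dist x₀ ξ₀ < dist x₁ ξ₀ ∧ 0 < f x₁ ξ₀)

/-- `f` is a stable constrained density for `(φ, ψ)`: no two points `x₀`, `ξ₀` of `ℝ^d` desire
each other. -/
structure IsStableConstrainedDensity (φ ψ : Measure (Space d)) (f : Space d → Space d → ℝ) :
    Prop where
  constrained : IsConstrainedDensity φ ψ f
  stable : ∀ x₀ ξ₀, ¬ (SiteDesires ψ f x₀ ξ₀ ∧ CenterDesires φ f x₀ ξ₀)

/-- The territory of the site `x`. -/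
def siteTerritory (f : Space d → Space d → ℝ) (x : Space d) : Set (Space d) :=
  {ξ | 0 < f x ξ}

/-- The territory of the center `ξ`. -/
def centerTerritory (f : Space d → Space d → ℝ) (ξ : Space d) : Set (Space d) :=
  {x | 0 < f x ξ}

end Deterministic

end StableDensity

/-! ### Analytic sets and measurable projection -/

section Projection

/-! Let ρ(ξ) be the supremal distance from ξ to its territory. By stability, if x has a partner
farther than η and η has one farther than x, then f(x,η) = 1 (`eq_one`); for fixed x such η have
mass at most 1 by the marginal bound.

Boundedness: a center with ρ = ∞ has partners tending to infinity. The balls around them with that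
center on the boundary swallow, along a subsequence, every bounded part of a shifted orthant, which
thus carries mass at most 1 of {ρ = ∞}. But by Poincaré recurrence, if {ρ = ∞} is not null, it has
infinite mass in every such orthant.

Finite mass: centers claimed from the ball of radius r satisfy |ξ| ≤ ρ(ξ) + r. If these have
infinite mass, recurrence gives |ξ| + r < ρ(ξ) on infinite mass too (`ae_covering_eq_top`), and
stability then bounds the territories of the points of the ball uniformly.

Recurrence needs ρ(ξ) as a measurable function of θ_ξ ω; since ρ is an uncountable supremum, this
rests on measurable projection. Exchanging sites and centers gives the other half. -/

/-- A finite Borel measure of an analytic set is approximated from inside by compact subsets. -/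
theorem MeasureTheory.AnalyticSet.exists_isCompact_le_measure {X : Type*} [TopologicalSpace X]
    [TopologicalSpace.PseudoMetrizableSpace X] [MeasurableSpace X] [BorelSpace X]
    {s : Set X} (hs : AnalyticSet s) (μ : Measure X) [IsFiniteMeasure μ] {c : ℝ≥0∞}
    (hc : c < μ s) : ∃ K ⊆ s, IsCompact K ∧ c ≤ μ K := by
  classical
  rw [AnalyticSet] at hs
  rcases hs with rfl | ⟨f, hf, rfl⟩
  · simp at hc
  let C : (ℕ → ℕ) → ℕ → Set (ℕ → ℕ) := fun b k => {α | ∀ i < k, α i ≤ b i}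
  -- Bounding one more coordinate by a large n keeps the measure above c, by continuity from below.
  have step : ∀ b k, ∃ n, c < μ (f '' C b k) → c < μ (f '' C (Function.update b k n) (k + 1)) := by
    intro b k
    by_cases h : c < μ (f '' C b k)
    · have hU : f '' C b k = ⋃ n, f '' C (Function.update b k n) (k + 1) := by
        rw [← Set.image_iUnion]
        congr 1
        ext α
        simp only [C, Set.mem_ofPred_eq, Set.mem_iUnion]
        constructor
        · intro hα
          refine ⟨α k, fun i hi => ?_⟩
          rcases Nat.lt_succ_iff_lt_or_eq.1 hi with h1 | rfl
          · rw [Function.update_of_ne h1.ne]; exact hα i h1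
          · simp
        · rintro ⟨n, hn⟩ i hi
          have := hn i (hi.trans k.lt_succ_self)
          rwa [Function.update_of_ne hi.ne] at this
      have hmono : Monotone fun n => f '' C (Function.update b k n) (k + 1) := by
        intro m n hmn
        refine Set.image_mono fun α hα i hi => (hα i hi).trans ?_
        by_cases hik : i = k
        · subst hik; simpa using hmn
        · simp [Function.update_of_ne hik]
      rw [hU, hmono.measure_iUnion, lt_iSup_iff] at h
      obtain ⟨n, hn⟩ := h
      exact ⟨n, fun _ => hn⟩
    · exact ⟨0, fun h' => absurd h' h⟩
  choose N hN using step
  let S : ℕ → (ℕ → ℕ) := fun k => Nat.rec (fun _ => 0) (fun k b => Function.update b k (N b k)) k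
  have hS : ∀ k, S (k + 1) = Function.update (S k) k (N (S k) k) := fun k => rfl
  have hSc : ∀ k, c < μ (f '' C (S k) k) := by
    intro k
    induction k with
    | zero => simpa [C] using hc
    | succ k ih => rw [hS]; exact hN _ _ ih
  let b : ℕ → ℕ := fun k => S (k + 1) k
  have hSb : ∀ k, ∀ i < k, S k i = b i := by
    intro k
    induction k with
    | zero => intro i hi; omega
    | succ k ih =>
      intro i hi
      rcases Nat.lt_succ_iff_lt_or_eq.1 hi with h1 | rfl
      · rw [hS, Function.update_of_ne h1.ne, ih i h1]
      · rfl
  have hbc : ∀ k, c < μ (f '' C b k) := by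
    intro k
    have : C b k = C (S k) k := by
      ext α
      exact forall₂_congr fun i hi => by rw [hSb k i hi]
    rw [this]
    exact hSc k
  let K : Set (ℕ → ℕ) := Set.univ.pi fun i => Set.Iic (b i)
  have hK : IsCompact K := isCompact_univ_pi fun i => (Set.finite_Iic (b i)).isCompact
  refine ⟨f '' K, Set.image_subset_range _ _, hK.image hf, ?_⟩
  rw [Set.measure_eq_iInf_isOpen (f '' K) μ]
  refine le_iInf₂ fun V hKV => le_iInf fun hV => ?_
  have hcyl : ∀ α ∈ K, ∃ k, PiNat.cylinder α k ⊆ f ⁻¹' V := by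
    intro α hα
    have hmem : f ⁻¹' V ∈ nhds α := (hV.preimage hf).mem_nhds (hKV ⟨α, hα, rfl⟩)
    obtain ⟨t, ⟨x, k, rfl⟩, hαt, ht⟩ :=
      (PiNat.isTopologicalBasis_cylinders (fun _ : ℕ => ℕ)).mem_nhds_iff.1 hmem
    exact ⟨k, by rwa [PiNat.mem_cylinder_iff_eq.1 hαt]⟩
  choose! κ hκ using hcyl
  obtain ⟨T, hTK, hT⟩ := hK.elim_nhds_subcover (fun α => PiNat.cylinder α (κ α)) fun α _ =>
    (PiNat.isOpen_cylinder _ α (κ α)).mem_nhds (PiNat.self_mem_cylinder α (κ α))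
  refine (hbc (T.sup κ)).le.trans (measure_mono ?_)
  rintro _ ⟨α, hα, rfl⟩
  -- Truncating α by b lands in K without changing the coordinates below `T.sup κ`, so α lies in the
  -- same cylinder as a point of K.
  have hβ : (fun i => min (α i) (b i)) ∈ K := fun i _ => Set.mem_Iic.2 (min_le_right _ _)
  obtain ⟨a, haT, ha⟩ := Set.mem_iUnion₂.1 (hT hβ)
  refine hκ a (hTK a haT) fun i hi => ?_
  rw [← ha i hi]
  exact (min_eq_left (hα i (hi.trans_le (Finset.le_sup haT)))).symm

/-- Analytic sets are null-measurable for every finite Borel measure. -/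
theorem MeasureTheory.AnalyticSet.nullMeasurableSet {X : Type*} [TopologicalSpace X] [T2Space X]
    [TopologicalSpace.PseudoMetrizableSpace X] [MeasurableSpace X] [BorelSpace X]
    {s : Set X} (hs : AnalyticSet s) (μ : Measure X) [IsFiniteMeasure μ] :
    NullMeasurableSet s μ := by
  obtain ⟨t, hts, htm, ht⟩ : ∃ t ⊆ s, MeasurableSet t ∧ μ s ≤ μ t := by
    rcases eq_or_ne (μ s) 0 with h0 | h0
    · exact ⟨∅, by simp, by simp, by simp [h0]⟩
    obtain ⟨u, -, hu, hlim⟩ := exists_seq_strictMono_tendsto' (pos_iff_ne_zero.2 h0)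
    choose K hKs hK hKc using fun n => hs.exists_isCompact_le_measure μ (hu n).2
    refine ⟨⋃ n, K n, Set.iUnion_subset hKs, .iUnion fun n => (hK n).measurableSet, ?_⟩
    exact le_of_tendsto' hlim fun n => (hKc n).trans (measure_mono (Set.subset_iUnion K n))
  have h1 : t =ᵐ[μ] toMeasurable μ s :=
    ae_eq_of_subset_of_measure_ge (hts.trans (subset_toMeasurable μ s))
      (by rwa [measure_toMeasurable]) htm.nullMeasurableSet (measure_ne_top _ _)
  have h2 : t =ᵐ[μ] s := by
    refine Filter.EventuallyLE.antisymm (LE.le.eventuallyLE hts) ?_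
    exact (LE.le.eventuallyLE (subset_toMeasurable μ s)).trans h1.symm.le
  exact htm.nullMeasurableSet.congr h2

/-- A measurable subset of `Ω × X` is the preimage of a measurable subset of `(ℕ → Bool) × X`
under a measurable map acting on the first factor only. -/
theorem MeasurableSet.exists_prodMap_preimage_eq {Ω X : Type*} [MeasurableSpace Ω]
    [MeasurableSpace X] {S : Set (Ω × X)} (hS : MeasurableSet S) :
    ∃ g : Ω → ℕ → Bool, Measurable g ∧ ∃ A : Set ((ℕ → Bool) × X), MeasurableSet A ∧
      S = Prod.map g id ⁻¹' A := by
  classical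
  induction S, hS using MeasurableSpace.induction_on_inter generateFrom_prod.symm isPiSystem_prod with
  | empty => exact ⟨fun _ _ => false, measurable_const, ∅, .empty, rfl⟩
  | basic t ht =>
    obtain ⟨u, hu, v, hv, rfl⟩ := ht
    refine ⟨fun ω _ => decide (ω ∈ u), measurable_pi_lambda _ fun _ => ?_,
      {b | b 0 = true} ×ˢ v, ?_, ?_⟩
    · refine measurable_to_bool ?_
      have : (fun ω => decide (ω ∈ u)) ⁻¹' {true} = u := by ext; simp
      rw [this]
      exact hu
    · exact (measurableSet_eq_fun (measurable_pi_apply 0) measurable_const).prod hv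
    · ext ⟨ω, x⟩; simp
  | compl t _ ih =>
    obtain ⟨g, hg, A, hA, rfl⟩ := ih
    exact ⟨g, hg, Aᶜ, hA.compl, rfl⟩
  | iUnion t _ _ ih =>
    choose g hg A hA hgA using ih
    -- Countably many codes are packed into one via `Nat.pair`; `π n` extracts the n-th.
    let π : ℕ → (ℕ → Bool) → (ℕ → Bool) := fun n b k => b (Nat.pair n k)
    have hπ : ∀ n, Measurable (π n) := fun n =>
      measurable_pi_lambda _ fun k => measurable_pi_apply _
    refine ⟨fun ω m => g m.unpair.1 ω m.unpair.2, measurable_pi_lambda _ fun m =>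
        (measurable_pi_apply _).comp (hg _), ⋃ n, Prod.map (π n) id ⁻¹' A n,
      .iUnion fun n => ((hπ n).prodMap measurable_id) (hA n), ?_⟩
    ext ⟨ω, x⟩
    simp [hgA, π]

/-- **Measurable projection**: the projection to `Ω` of a measurable subset of `Ω × X`, with `X`
standard Borel, is null-measurable for every finite measure. -/
theorem MeasurableSet.nullMeasurableSet_exists_mem {Ω X : Type*} [MeasurableSpace Ω]
    [MeasurableSpace X] [StandardBorelSpace X] {S : Set (Ω × X)} (hS : MeasurableSet S)
    (μ : Measure Ω) [IsFiniteMeasure μ] : NullMeasurableSet {ω | ∃ x, (ω, x) ∈ S} μ := by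
  obtain ⟨g, hg, A, hA, rfl⟩ := hS.exists_prodMap_preimage_eq
  -- The projection is the preimage under g of an analytic subset of Cantor space, so Ω itself needs
  -- no topology.
  have h1 : AnalyticSet (Prod.fst '' A) := hA.analyticSet_image measurable_fst
  have h2 := (h1.nullMeasurableSet (μ.map g)).preimage (hg.quasiMeasurePreserving μ)
  convert h2 using 1
  ext ω
  simp

/-- The supremum over a standard Borel space of a jointly measurable function is a.e. measurable
in the remaining variable. -/
theorem Measurable.aemeasurable_iSup_of_standardBorel {Ω X : Type*} [MeasurableSpace Ω]
    [MeasurableSpace X] [StandardBorelSpace X] {g : Ω × X → ℝ≥0∞} (hg : Measurable g)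
    (μ : Measure Ω) [SFinite μ] : AEMeasurable (fun ω => ⨆ x, g (ω, x)) μ := by
  suffices h : AEMeasurable (fun ω => ⨆ x, g (ω, x)) μ.toFinite from
    h.mono_ac (absolutelyContinuous_toFinite μ)
  refine NullMeasurable.aemeasurable (f := fun ω => ⨆ x, g (ω, x)) ?_
  refine @measurable_of_Ioi _ (NullMeasurableSpace Ω μ.toFinite) _ _ _ _ _ _ _ _ fun a => ?_
  have := (hg measurableSet_Ioi : MeasurableSet (g ⁻¹' Set.Ioi a)).nullMeasurableSet_exists_mem
    μ.toFinite
  have hpre : (fun ω => ⨆ x, g (ω, x)) ⁻¹' Set.Ioi a = {ω | ∃ x, (ω, x) ∈ g ⁻¹' Set.Ioi a} := by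
    ext ω
    simp [lt_iSup_iff]
  exact hpre ▸ this

end Projection

/-! ### S-finiteness of kernels -/

section Kernel

open ProbabilityTheory

variable {α β : Type*} [MeasurableSpace α] [MeasurableSpace β]

/-- A kernel of finite measures, not necessarily with a uniform bound, is s-finite. -/
theorem ProbabilityTheory.Kernel.isSFiniteKernel_of_forall_isFiniteMeasure (κ : Kernel α β)
    (hκ : ∀ a, IsFiniteMeasure (κ a)) : IsSFiniteKernel κ := by
  classical
  -- The source is cut by the integer part of the total mass, which is below n + 1 on piece n.
  let N : α → ℕ := fun a => ⌊(κ a Set.univ).toNNReal⌋₊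
  have hN : Measurable N :=
    Nat.measurable_floor.comp ((κ.measurable_coe MeasurableSet.univ).ennreal_toNNReal)
  have hA : ∀ n, MeasurableSet (N ⁻¹' {n}) := fun n => hN (measurableSet_singleton n)
  have hsum : κ = Kernel.sum fun n => Kernel.piecewise (hA n) κ 0 := by
    ext a s hs
    rw [Kernel.sum_apply' _ _ hs, tsum_eq_single (N a)]
    · simp [Kernel.piecewise_apply]
    · intro n hn
      simp [Kernel.piecewise_apply, hn.symm]
  rw [hsum]
  have hfin : ∀ n, IsFiniteKernel (Kernel.piecewise (hA n) κ 0) := by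
    refine fun n => ⟨⟨(n + 1 : ℝ≥0), ENNReal.coe_lt_top, fun a => ?_⟩⟩
    by_cases ha : N a = n
    · have h1 : (κ a Set.univ).toNNReal < n + 1 := by
        rw [← ha]; exact Nat.lt_floor_add_one _
      have h2 : κ a Set.univ < ((n + 1 : ℝ≥0) : ℝ≥0∞) := by
        rw [← ENNReal.coe_toNNReal (measure_ne_top (κ a) Set.univ)]
        exact ENNReal.coe_lt_coe.2 h1
      simpa [Kernel.piecewise_apply, ha] using h2.le
    · simp [Kernel.piecewise_apply, ha]
  infer_instance

/-- A kernel is s-finite as soon as all its measures are finite on the members of one countable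
measurable partition. -/
theorem ProbabilityTheory.Kernel.isSFiniteKernel_of_forall_fiber_lt_top (κ : Kernel α β)
    {c : β → ℕ} (hc : Measurable c) (hκ : ∀ a n, κ a (c ⁻¹' {n}) < ∞) : IsSFiniteKernel κ := by
  have hA : ∀ n, MeasurableSet (c ⁻¹' {n}) := fun n => hc (measurableSet_singleton n)
  have hsum : κ = Kernel.sum fun n => κ.restrict (hA n) := by
    ext a s hs
    rw [Kernel.sum_apply' _ _ hs]
    simp_rw [Kernel.restrict_apply]
    have hU : (⋃ n, c ⁻¹' {n}) = Set.univ := by ext; simp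
    conv_lhs => rw [← Measure.restrict_univ (μ := κ a), ← hU]
    rw [Measure.restrict_iUnion (fun i j hij => Disjoint.preimage c (by simpa using hij)) hA,
      Measure.sum_apply _ hs]
  rw [hsum]
  have hfin : ∀ n, IsSFiniteKernel (κ.restrict (hA n)) := by
    refine fun n => Kernel.isSFiniteKernel_of_forall_isFiniteMeasure _ fun a => ⟨?_⟩
    rw [Kernel.restrict_apply, Measure.restrict_apply_univ]
    exact hκ a n
  infer_instance

end Kernel

namespace StableDensity

variable {d : ℕ} {Ω : Type*} [MeasurableSpace Ω] {θ : Space d → Ω → Ω} {P : Measure Ω}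
  {Ψ : Ω → Measure (Space d)}

/-! ### Stationary random measures and recurrence -/

section Flow

theorem IsMeasurableFlow.measurable_apply (hθ : IsMeasurableFlow θ) (ω : Ω) :
    Measurable fun ξ => θ ξ ω :=
  hθ.measurable.comp (measurable_const.prodMk measurable_id)

theorem IsMeasurableFlow.iterate_eq (hθ : IsMeasurableFlow θ) (v : Space d) (k : ℕ) (ω : Ω) :
    (θ v)^[k] ω = θ ((k : ℝ) • v) ω := by
  induction k with
  | zero => simp [hθ.zero]
  | succ k ih =>
    rw [Function.iterate_succ_apply', ih, hθ.comp]
    congr 1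
    push_cast
    module

/-- A measurable map into the locally finite measures, as a kernel. -/
def IsStationaryRandomMeasure.kernel (hΨ : IsStationaryRandomMeasure θ P Ψ) :
    ProbabilityTheory.Kernel Ω (Space d) :=
  ⟨Ψ, hΨ.measurable⟩

theorem IsStationaryRandomMeasure.kernel_apply (hΨ : IsStationaryRandomMeasure θ P Ψ) (ω : Ω) :
    hΨ.kernel ω = Ψ ω :=
  rfl

/-- The shells ⌊‖ξ‖⌋ = n are bounded, hence of finite mass for every ω. -/
theorem IsStationaryRandomMeasure.isSFiniteKernel (hΨ : IsStationaryRandomMeasure θ P Ψ) :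
    ProbabilityTheory.IsSFiniteKernel hΨ.kernel := by
  refine ProbabilityTheory.Kernel.isSFiniteKernel_of_forall_fiber_lt_top _
    (c := fun ξ => ⌊‖ξ‖⌋₊) (Nat.measurable_floor.comp measurable_norm) fun ω n => ?_
  have := hΨ.locallyFinite ω
  rw [hΨ.kernel_apply]
  refine (measure_mono fun ξ hξ => ?_).trans_lt
    (measure_closedBall_lt_top (x := (0 : Space d)) (r := n + 1))
  have h1 : ⌊‖ξ‖⌋₊ = n := by simpa using hξ
  rw [mem_closedBall_zero_iff, ← h1]
  exact (Nat.lt_floor_add_one _).le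

/-- The sets `{ξ | (h (θ_ξ ω), ξ) ∈ A}`, i.e. the points whose mark and position lie in `A`, are
moved along by the flow. -/
theorem IsStationaryRandomMeasure.apply_flow (hΨ : IsStationaryRandomMeasure θ P Ψ)
    (hθ : IsMeasurableFlow θ) (h : Ω → ℝ≥0∞) (A : Set (ℝ≥0∞ × Space d)) (s : Space d) (ω : Ω) :
    Ψ (θ s ω) {ξ | (h (θ ξ (θ s ω)), ξ) ∈ A} = Ψ ω {ξ | (h (θ ξ ω), ξ - s) ∈ A} := by
  rw [hΨ.flowAdapted, shiftMeasure]
  refine ((MeasurableEquiv.subRight s).map_apply _).trans ?_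
  congr 1
  ext ξ
  change (h (θ (ξ - s) (θ s ω)), ξ - s) ∈ A ↔ (h (θ ξ ω), ξ - s) ∈ A
  rw [hθ.comp, sub_add_cancel]

theorem IsStationaryRandomMeasure.measurable_apply_marked (hΨ : IsStationaryRandomMeasure θ P Ψ)
    (hθ : IsMeasurableFlow θ) {h : Ω → ℝ≥0∞} (hh : Measurable h) {A : Set (ℝ≥0∞ × Space d)}
    (hA : MeasurableSet A) : Measurable fun ω => Ψ ω {ξ | (h (θ ξ ω), ξ) ∈ A} := by
  have := hΨ.isSFiniteKernel
  exact ProbabilityTheory.Kernel.measurable_kernel_prodMk_left (κ := hΨ.kernel)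
    (((hh.comp hθ.measurable).prodMk measurable_snd) hA)

/-- Poincaré recurrence for the mass of the points whose mark and position relative to the
observer lie in a given set. -/
theorem IsStationaryRandomMeasure.ae_frequently_apply_mem [IsFiniteMeasure P]
    (hΨ : IsStationaryRandomMeasure θ P Ψ) (hθ : IsMeasurableFlow θ) {h : Ω → ℝ≥0∞}
    (hh : Measurable h) {A : Set (ℝ≥0∞ × Space d)} (hA : MeasurableSet A) {T : Set ℝ≥0∞}
    (hT : MeasurableSet T) (v : Space d) :
    ∀ᵐ ω ∂P, Ψ ω {ξ | (h (θ ξ ω), ξ) ∈ A} ∈ T →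
      ∃ᶠ k : ℕ in Filter.atTop, Ψ ω {ξ | (h (θ ξ ω), ξ - (k : ℝ) • v) ∈ A} ∈ T := by
  have hE := (hΨ.measurable_apply_marked hθ hh hA) hT
  filter_upwards [(hΨ.stationary v).conservative.ae_mem_imp_frequently_image_mem
    hE.nullMeasurableSet] with ω hω hωT
  refine (hω hωT).mono fun k hk => ?_
  rw [hθ.iterate_eq] at hk
  rw [← hΨ.apply_flow hθ]
  exact hk

end Flow

end StableDensity

namespace StableDensity

variable {d : ℕ} {Ω : Type*} [MeasurableSpace Ω] {θ : Space d → Ω → Ω} {P : Measure Ω}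
  {Ψ : Ω → Measure (Space d)}

/-! ### Geometry of orthants -/

section Orthant

/-- The vector with coordinates `±1` prescribed by `ε`. -/
noncomputable def signVector (ε : Fin d → Bool) : Space d :=
  WithLp.toLp 2 fun i => if ε i then 1 else -1

theorem signVector_mul_self (ε : Fin d → Bool) (i : Fin d) :
    signVector ε i * signVector ε i = 1 := by
  by_cases h : ε i <;> simp [signVector, h]

theorem abs_signVector_mul (ε : Fin d → Bool) (i : Fin d) (a : ℝ) :
    |signVector ε i * a| = |a| := by
  by_cases h : ε i <;> simp [signVector, h]

theorem norm_signVector_sq (ε : Fin d → Bool) : ‖signVector ε‖ ^ 2 = d := by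
  rw [EuclideanSpace.real_norm_sq_eq]
  simp [sq, signVector_mul_self]

theorem exists_signVector_mul_nonneg (y : Space d) :
    ∃ ε : Fin d → Bool, ∀ i, 0 ≤ signVector ε i * y i := by
  refine ⟨fun i => decide (0 ≤ y i), fun i => ?_⟩
  by_cases h : 0 ≤ y i
  · simp [signVector, h]
  · simp [signVector, h, (not_le.1 h).le]

/-- With matching signs the inner product is Σ |y i| |v i|, which dominates the ℓ¹ norm and so the
Euclidean one. -/
theorem norm_le_inner_of_orthant {ε : Fin d → Bool} {y v : Space d}
    (hy : ∀ i, 0 ≤ signVector ε i * y i) (hv : ∀ i, 1 ≤ signVector ε i * v i) :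
    ‖y‖ ≤ inner ℝ y v := by
  have h1 : ‖y‖ ≤ ∑ i, |y i| := by
    refine (sq_le_sq₀ (norm_nonneg _) (Finset.sum_nonneg fun i _ => abs_nonneg _)).1 ?_
    rw [EuclideanSpace.real_norm_sq_eq]
    refine le_trans (le_of_eq ?_) (Finset.sum_sq_le_sq_sum_of_nonneg fun i _ => abs_nonneg (y i))
    simp
  refine h1.trans ?_
  have h2 : inner ℝ y v = ∑ i, y i * v i := by
    simp [PiLp.inner_apply, mul_comm]
  rw [h2]
  refine Finset.sum_le_sum fun i _ => ?_
  have h3 : y i * v i = (signVector ε i * y i) * (signVector ε i * v i) := by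
    linear_combination (-(y i * v i)) * signVector_mul_self ε i
  rw [h3, ← abs_signVector_mul ε i (y i), abs_of_nonneg (hy i)]
  nlinarith [hy i, hv i]

/-- Moving by `t` along the diagonal of an orthant brings one closer by at least `t - 1` to every
remote point of that orthant. -/
theorem norm_sub_smul_signVector_add_lt {ε : Fin d → Bool} {y : Space d}
    (hy : ∀ i, 0 ≤ signVector ε i * y i) {s t : ℝ} (hs : 0 ≤ s) (hst : s + 1 ≤ t)
    (hyt : t ^ 2 * d + s < ‖y‖) : ‖y - t • signVector ε‖ + s < ‖y‖ := by
  have hin : ‖y‖ ≤ inner ℝ y (signVector ε) :=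
    norm_le_inner_of_orthant hy fun i => (signVector_mul_self ε i).ge
  have hsq : ‖y - t • signVector ε‖ ^ 2 =
      ‖y‖ ^ 2 - 2 * (t * inner ℝ y (signVector ε)) + t ^ 2 * d := by
    rw [norm_sub_sq_real, inner_smul_right, norm_smul, mul_pow, norm_signVector_sq,
      Real.norm_eq_abs, sq_abs]
  have htd : 0 ≤ t ^ 2 * (d : ℝ) := by positivity
  have h1 : ‖y - t • signVector ε‖ ^ 2 < (‖y‖ - s) ^ 2 := by
    -- In the expansion, 2s‖y‖ of the gain 2(s + 1)‖y‖ pays for s; the remaining 2‖y‖ beats t²d.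
    have h2 : (s + 1) * ‖y‖ ≤ t * inner ℝ y (signVector ε) :=
      mul_le_mul hst hin (norm_nonneg _) (by linarith)
    rw [hsq]
    nlinarith
  have h2 := lt_of_pow_lt_pow_left₀ 2 (by linarith) h1
  linarith

end Orthant

/-! ### Consequences of recurrence along diagonals -/

section Recurrence

/-- Write `ρ(ξ) = h (θ_ξ ω)` for the mark of `ξ`. If infinite mass has balls `B(ξ, ρ(ξ))` that meet
some fixed ball around the origin, then every ball around the origin is contained in the balls
`B(ξ, ρ(ξ))` of infinite mass. -/
theorem IsStationaryRandomMeasure.ae_covering_eq_top [IsFiniteMeasure P]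
    (hΨ : IsStationaryRandomMeasure θ P Ψ) (hθ : IsMeasurableFlow θ) {h : Ω → ℝ≥0∞}
    (hh : Measurable h) :
    ∀ᵐ ω ∂P, ∀ r : ℕ, Ψ ω {ξ | ‖ξ‖ₑ ≤ h (θ ξ ω) + r} = ∞ →
      ∀ r' : ℕ, Ψ ω {ξ | ‖ξ‖ₑ + r' < h (θ ξ ω)} = ∞ := by
  -- Recurrence is applied to the event that the mass is finite: it would recur at observers k • ε,
  -- yet the mass seen there is infinite for all large k.
  have hrec : ∀ᵐ ω ∂P, ∀ (ε : Fin d → Bool) (r' : ℕ),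
      Ψ ω {ξ | ‖ξ‖ₑ + r' < h (θ ξ ω)} ∈ ({∞}ᶜ : Set ℝ≥0∞) →
      ∃ᶠ k : ℕ in Filter.atTop,
        Ψ ω {ξ | ‖ξ - (k : ℝ) • signVector ε‖ₑ + r' < h (θ ξ ω)} ∈ ({∞}ᶜ : Set ℝ≥0∞) := by
    simp_rw [ae_all_iff]
    intro ε r'
    exact hΨ.ae_frequently_apply_mem hθ hh (A := {p | ‖p.2‖ₑ + r' < p.1})
      (measurableSet_lt (by fun_prop) (by fun_prop)) (measurableSet_singleton ∞).compl
      (signVector ε)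
  filter_upwards [hrec] with ω hω r hr r'
  have := hΨ.locallyFinite ω
  obtain ⟨ε, hε⟩ : ∃ ε : Fin d → Bool,
      Ψ ω {ξ | ‖ξ‖ₑ ≤ h (θ ξ ω) + r ∧ ∀ i, 0 ≤ signVector ε i * ξ i} = ∞ := by
    by_contra! hcon
    have hsub : {ξ | ‖ξ‖ₑ ≤ h (θ ξ ω) + r} ⊆
        ⋃ ε : Fin d → Bool, {ξ | ‖ξ‖ₑ ≤ h (θ ξ ω) + r ∧ ∀ i, 0 ≤ signVector ε i * ξ i} := by
      intro ξ hξ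
      obtain ⟨ε, hε⟩ := exists_signVector_mul_nonneg ξ
      exact Set.mem_iUnion.2 ⟨ε, hξ, hε⟩
    have hle := (measure_mono hsub).trans (measure_iUnion_le (μ := Ψ ω) _)
    rw [hr, tsum_fintype, top_le_iff, ENNReal.sum_eq_top] at hle
    obtain ⟨ε, -, hε⟩ := hle
    exact hcon ε hε
  by_contra hfin
  obtain ⟨k, hk, hkr⟩ := ((hω ε r' (by simpa using hfin)).and_eventually
    (Filter.eventually_ge_atTop (r + r' + 1))).exists
  refine hk ?_
  rw [Set.mem_singleton_iff, ← top_le_iff]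
  -- Removing this ball costs finite mass and leaves only points remote enough for the orthant
  -- estimate.
  have hball : Ψ ω (Metric.closedBall 0 ((k : ℝ) ^ 2 * d + (r + r'))) ≠ ∞ :=
    measure_closedBall_lt_top.ne
  refine le_of_eq_of_le (b := Ψ ω ({ξ | ‖ξ‖ₑ ≤ h (θ ξ ω) + r ∧
    ∀ i, 0 ≤ signVector ε i * ξ i} \ Metric.closedBall 0 ((k : ℝ) ^ 2 * d + (r + r')))) ?_ ?_
  · refine (top_le_iff.1 (le_trans ?_ le_measure_sdiff)).symm
    rw [hε, ENNReal.top_sub hball]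
  refine measure_mono ?_
  rintro ξ ⟨⟨hξ, hξε⟩, hξk⟩
  rw [mem_closedBall_zero_iff, not_le] at hξk
  have hlt := norm_sub_smul_signVector_add_lt hξε (s := r + r') (t := k) (by positivity)
    (by exact_mod_cast hkr) hξk
  have hlt' : ‖ξ - (k : ℝ) • signVector ε‖ₑ + (r' : ℝ≥0∞) + r < ‖ξ‖ₑ := by
    rw [← ofReal_norm, ← ofReal_norm, ← ENNReal.ofReal_natCast r', ← ENNReal.ofReal_natCast r,
      ← ENNReal.ofReal_add (by positivity) (by positivity),
      ← ENNReal.ofReal_add (by positivity) (by positivity),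
      ENNReal.ofReal_lt_ofReal_iff_of_nonneg (by positivity)]
    linarith
  exact lt_of_add_lt_add_right (hlt'.trans_le hξ)

/-- A nonzero stationary thinning of `Ψ` puts infinite mass on every orthant. -/
theorem IsStationaryRandomMeasure.ae_orthant_eq_top [IsFiniteMeasure P]
    (hΨ : IsStationaryRandomMeasure θ P Ψ) (hθ : IsMeasurableFlow θ) (hd : 0 < d)
    {h : Ω → ℝ≥0∞} (hh : Measurable h) :
    ∀ᵐ ω ∂P, Ψ ω {ξ | h (θ ξ ω) = ∞} ≠ 0 → ∀ (ε : Fin d → Bool) (m : ℕ),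
      Ψ ω {ξ | h (θ ξ ω) = ∞ ∧ ∀ i, m < signVector ε i * ξ i} = ∞ := by
  have hrec : ∀ᵐ ω ∂P, ∀ (ε : Fin d → Bool) (n j : ℕ),
      Ψ ω {ξ | h (θ ξ ω) = ∞ ∧ ‖ξ‖ ≤ n} ∈ Set.Ioi ((j : ℝ≥0∞)⁻¹) →
      ∃ᶠ k : ℕ in Filter.atTop,
        Ψ ω {ξ | h (θ ξ ω) = ∞ ∧ ‖ξ - (k : ℝ) • signVector ε‖ ≤ n} ∈ Set.Ioi ((j : ℝ≥0∞)⁻¹) := by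
    simp_rw [ae_all_iff]
    intro ε n j
    exact hΨ.ae_frequently_apply_mem hθ hh (A := {p | p.1 = ∞ ∧ ‖p.2‖ ≤ n})
      ((measurableSet_eq_fun measurable_fst measurable_const).inter
        (measurableSet_le measurable_snd.norm measurable_const)) measurableSet_Ioi (signVector ε)
  filter_upwards [hrec] with ω hω hne ε m
  have hmark : Measurable fun ξ => h (θ ξ ω) := hh.comp (hθ.measurable_apply ω)
  obtain ⟨n, hn⟩ : ∃ n : ℕ, Ψ ω {ξ | h (θ ξ ω) = ∞ ∧ ‖ξ‖ ≤ n} ≠ 0 := by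
    by_contra! hcon
    refine hne (measure_mono_null (fun ξ hξ => ?_) (measure_iUnion_null hcon))
    obtain ⟨n, hn⟩ := exists_nat_ge ‖ξ‖
    exact Set.mem_iUnion.2 ⟨n, hξ, hn⟩
  obtain ⟨j, hj⟩ := ENNReal.exists_inv_nat_lt hn
  let O : ℕ → Set (Space d) := fun l => {ξ | h (θ ξ ω) = ∞ ∧ ∀ i, (l : ℝ) < signVector ε i * ξ i}
  -- For k ≥ l + n + 1 the ball of radius n around k • ε lies inside the l-th shifted orthant.
  have hO : ∀ l, (j : ℝ≥0∞)⁻¹ ≤ Ψ ω (O l) := by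
    intro l
    obtain ⟨k, hk, hkl⟩ := ((hω ε n j hj).and_eventually
      (Filter.eventually_ge_atTop (l + n + 1))).exists
    refine (Set.mem_Ioi.1 hk).le.trans (measure_mono ?_)
    rintro ξ ⟨hξ, hξn⟩
    refine ⟨hξ, fun i => ?_⟩
    have h1 : |(ξ - (k : ℝ) • signVector ε) i| ≤ n := (PiLp.norm_apply_le _ i).trans hξn
    rw [← abs_signVector_mul ε i] at h1
    have h2 : signVector ε i * (ξ - (k : ℝ) • signVector ε) i = signVector ε i * ξ i - k := by
      simp only [PiLp.sub_apply, PiLp.smul_apply, smul_eq_mul]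
      linear_combination (-(k : ℝ)) * signVector_mul_self ε i
    have h3 : (l : ℝ) + n + 1 ≤ k := by exact_mod_cast hkl
    rw [h2] at h1
    linarith [(abs_le.1 h1).1]
  have hmeas : ∀ l, MeasurableSet (O l) := fun l => by
    have hOl : O l = {ξ | h (θ ξ ω) = ∞} ∩ ⋂ i, {ξ | (l : ℝ) < signVector ε i * ξ i} := by
      ext; simp [O]
    rw [hOl]
    exact (measurableSet_eq_fun hmark measurable_const).inter
      (.iInter fun i => measurableSet_lt measurable_const (by fun_prop))
  have hanti : Antitone O := fun a b hab ξ hξ =>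
    ⟨hξ.1, fun i => lt_of_le_of_lt (by exact_mod_cast hab) (hξ.2 i)⟩
  -- The shifted orthants decrease to ∅ (here d > 0 matters), so finite mass would force the masses
  -- to 0, below 1/j.
  by_contra hfin
  have hlim := tendsto_measure_iInter_atTop (fun l => (hmeas l).nullMeasurableSet) hanti ⟨m, hfin⟩
  have hempty : ⋂ l, O l = ∅ := by
    refine Set.eq_empty_of_forall_notMem fun ξ hξ => ?_
    obtain ⟨l, hl⟩ := exists_nat_ge (signVector ε ⟨0, hd⟩ * ξ ⟨0, hd⟩)
    exact absurd ((Set.mem_iInter.1 hξ l).2 ⟨0, hd⟩) (not_lt.2 hl)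
  rw [hempty, measure_empty] at hlim
  have := ge_of_tendsto' hlim hO
  simp at this

end Recurrence

end StableDensity

namespace StableDensity

variable {d : ℕ}

/-! ### Deterministic consequences of stability -/

section Reach

variable {φ ψ : Measure (Space d)} {f : Space d → Space d → ℝ}

open Classical in
/-- The supremum of the distances from the center `ξ` to the points of its territory. -/
noncomputable def reach (f : Space d → Space d → ℝ) (ξ : Space d) : ℝ≥0∞ :=
  ⨆ x, if 0 < f x ξ then edist x ξ else 0

theorem edist_le_reach {x ξ : Space d} (h : 0 < f x ξ) : edist x ξ ≤ reach f ξ :=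
  le_iSup_of_le x (by simp [h])

theorem edist_lt_edist_iff {x y z w : Space d} : edist x y < edist z w ↔ dist x y < dist z w := by
  rw [edist_dist, edist_dist, ENNReal.ofReal_lt_ofReal_iff_of_nonneg dist_nonneg]

theorem lt_reach_iff {a : ℝ≥0∞} {ξ : Space d} :
    a < reach f ξ ↔ ∃ x, 0 < f x ξ ∧ a < edist x ξ := by
  simp only [reach, lt_iSup_iff]
  refine exists_congr fun x => ?_
  by_cases h : 0 < f x ξ <;> simp [h]

theorem isBounded_centerTerritory {ξ : Space d} (h : reach f ξ ≠ ∞) :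
    Bornology.IsBounded (centerTerritory f ξ) := by
  refine Metric.isBounded_closedBall (x := ξ) (r := (reach f ξ).toReal) |>.subset fun x hx => ?_
  rw [Metric.mem_closedBall, dist_edist]
  exact ENNReal.toReal_mono h (edist_le_reach hx)

/-- If `x` has a partner `ξ` farther away than the center `ξ'`, and `ξ'` has a partner farther away
than `x`, then stability forces the maximal value at `(x, ξ')`. -/
theorem IsStableConstrainedDensity.eq_one (hf : IsStableConstrainedDensity φ ψ f)
    {x x' ξ ξ' : Space d} (hξ : 0 < f x ξ) (hd : dist x ξ' < dist x ξ) (hx' : 0 < f x' ξ')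
    (hd' : dist x ξ' < dist x' ξ') : f x ξ' = 1 := by
  by_contra hne
  have hlt := lt_of_le_of_ne (hf.constrained.le_one x ξ') hne
  exact hf.stable x ξ' ⟨⟨hlt, .inr ⟨ξ, hd, hξ⟩⟩, ⟨hlt, .inr ⟨x', hd', hx'⟩⟩⟩

theorem IsConstrainedDensity.measure_eq_one_le (hf : IsConstrainedDensity φ ψ f) (x : Space d) :
    ψ {ξ | f x ξ = 1} ≤ 1 := by
  have hm : Measurable fun ξ => ENNReal.ofReal (f x ξ) :=
    (hf.measurable.comp (measurable_const.prodMk measurable_id)).ennreal_ofReal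
  have := (meas_ge_le_lintegral_div hm.aemeasurable one_ne_zero ENNReal.one_ne_top).trans
    (ENNReal.div_le_of_le_mul (by simpa using hf.site_le x))
  refine (measure_mono fun ξ hξ => ?_).trans this
  have h1 : f x ξ = 1 := hξ
  simp [h1]

/-- A point `x` in the territory of `ξ` sees at most unit mass of centers with unbounded territory
closer than `ξ`. -/
theorem IsStableConstrainedDensity.measure_reach_eq_top_inter_ball_le
    (hf : IsStableConstrainedDensity φ ψ f) {x ξ : Space d} (hx : 0 < f x ξ) :
    ψ ({η | reach f η = ∞} ∩ Metric.ball x (dist x ξ)) ≤ 1 := by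
  refine (measure_mono ?_).trans (hf.constrained.measure_eq_one_le x)
  rintro η ⟨hη, hηx⟩
  have hη' : edist x η < reach f η := by
    rw [show reach f η = ∞ from hη]; exact edist_lt_top _ _
  obtain ⟨x', hx', hd'⟩ := lt_reach_iff.1 hη'
  refine hf.eq_one hx ?_ hx' (edist_lt_edist_iff.1 hd')
  rwa [dist_comm, ← Metric.mem_ball]

/-- If some center has an unbounded territory, then in some orthant the centers with unbounded
territory have at most unit mass. -/
theorem IsStableConstrainedDensity.exists_orthant_measure_le_one
    (hf : IsStableConstrainedDensity φ ψ f) {ξ : Space d} (hξ : reach f ξ = ∞) :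
    ∃ (ε : Fin d → Bool) (m : ℕ),
      ψ {η | reach f η = ∞ ∧ ∀ i, m < signVector ε i * η i} ≤ 1 := by
  have hx : ∀ n : ℕ, ∃ x, 0 < f x ξ ∧ (n : ℝ) < dist x ξ := by
    intro n
    have : ENNReal.ofReal n < reach f ξ := by rw [hξ]; exact ENNReal.ofReal_lt_top
    obtain ⟨x, hx, hn⟩ := lt_reach_iff.1 this
    refine ⟨x, hx, ?_⟩
    rw [edist_dist] at hn
    exact (ENNReal.ofReal_lt_ofReal_iff_of_nonneg (by positivity)).1 hn
  choose x hxf hxn using hx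
  obtain ⟨ε, hε⟩ : ∃ ε : Fin d → Bool, ∃ᶠ n in Filter.atTop,
      ∀ i, 0 ≤ signVector ε i * (x n - ξ) i := by
    rw [← Filter.frequently_exists]
    exact Filter.Frequently.of_forall fun n => exists_signVector_mul_nonneg _
  -- This m makes every signed coordinate of η - ξ at least 1. Then ⟨x n - ξ, η - ξ⟩ ≥ ‖x n - ξ‖ > n
  -- ≥ ‖η - ξ‖², which puts η closer to x n than ξ.
  obtain ⟨m, hm⟩ := exists_nat_ge (‖ξ‖ + 1)
  refine ⟨ε, m, ?_⟩
  let V : ℕ → Set (Space d) := fun N =>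
    {η | (reach f η = ∞ ∧ ∀ i, (m : ℝ) < signVector ε i * η i) ∧ ‖η - ξ‖ ^ 2 ≤ N}
  have hV : {η | reach f η = ∞ ∧ ∀ i, (m : ℝ) < signVector ε i * η i} = ⋃ N, V N := by
    ext η
    simp only [V, Set.mem_iUnion, Set.mem_ofPred_eq, exists_and_left, iff_self_and]
    exact fun _ => exists_nat_ge _
  have hmono : Monotone V := fun a b hab η hη => ⟨hη.1, hη.2.trans (by exact_mod_cast hab)⟩
  rw [hV, hmono.measure_iUnion]
  refine iSup_le fun N => ?_
  obtain ⟨n, hn, hNn⟩ := (hε.and_eventually (Filter.eventually_ge_atTop N)).exists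
  refine (measure_mono ?_).trans (hf.measure_reach_eq_top_inter_ball_le (hxf n))
  rintro η ⟨⟨hη, hηm⟩, hηN⟩
  refine ⟨hη, ?_⟩
  have hv : ∀ i, 1 ≤ signVector ε i * (η - ξ) i := by
    intro i
    have h1 : |ξ i| ≤ ‖ξ‖ := PiLp.norm_apply_le ξ i
    rw [← abs_signVector_mul ε i] at h1
    have h2 := hηm i
    rw [PiLp.sub_apply, mul_sub]
    linarith [(abs_le.1 h1).2]
  have hin := norm_le_inner_of_orthant hn hv
  have hsq : ‖x n - η‖ ^ 2 < ‖x n - ξ‖ ^ 2 := by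
    have h1 : x n - η = (x n - ξ) - (η - ξ) := by abel
    have h2 := hxn n
    rw [dist_eq_norm] at h2
    have h3 : (N : ℝ) ≤ n := by exact_mod_cast hNn
    have h4 : (0 : ℝ) ≤ N := by positivity
    rw [h1, norm_sub_sq_real]
    linarith
  rw [Metric.mem_ball, dist_comm, dist_eq_norm, dist_eq_norm]
  exact lt_of_pow_lt_pow_left₀ 2 (norm_nonneg _) hsq

/-- If more than unit mass of centers reaches beyond the ball of radius `r`, then the territories
of the points in this ball are uniformly bounded. -/
theorem IsStableConstrainedDensity.isBounded_iUnion_siteTerritory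
    (hf : IsStableConstrainedDensity φ ψ f) {r : ℕ} (h : 1 < ψ {ξ | ‖ξ‖ₑ + r < reach f ξ})
    {B : Set (Space d)} (hB : B ⊆ Metric.closedBall 0 r) :
    Bornology.IsBounded (⋃ x ∈ B, siteTerritory f x) := by
  let K : ℕ → Set (Space d) := fun n => {ξ | ‖ξ‖ₑ + r < reach f ξ ∧ ‖ξ‖ ≤ n}
  have hK : {ξ | ‖ξ‖ₑ + r < reach f ξ} = ⋃ n, K n := by
    ext ξ
    simp only [K, Set.mem_iUnion, Set.mem_ofPred_eq, exists_and_left, iff_self_and]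
    exact fun _ => exists_nat_ge _
  have hmono : Monotone K := fun a b hab η hη => ⟨hη.1, hη.2.trans (by exact_mod_cast hab)⟩
  rw [hK, hmono.measure_iUnion, lt_iSup_iff] at h
  obtain ⟨n, hn⟩ := h
  refine (Metric.isBounded_closedBall (x := (0 : Space d)) (r := r + n + r)).subset ?_
  refine Set.iUnion₂_subset fun x hx ξ hξ => ?_
  have hxr : ‖x‖ ≤ r := mem_closedBall_zero_iff.1 (hB hx)
  -- The value 1 cannot hold on all of `K n`. Such an η caps the distance from x to its partners,
  -- and n does not depend on x.
  obtain ⟨η, ⟨hη, hηn⟩, hη1⟩ : ∃ η ∈ K n, f x η ≠ 1 := by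
    by_contra! hcon
    exact absurd ((measure_mono hcon).trans (hf.constrained.measure_eq_one_le x)) (not_le.2 hn)
  obtain ⟨x', hx', hd'⟩ := lt_reach_iff.1 hη
  have hd'' : dist x η < dist x' η := by
    rw [← edist_lt_edist_iff]
    refine lt_of_le_of_lt ?_ hd'
    rw [edist_dist, ← ofReal_norm, ← ENNReal.ofReal_natCast,
      ← ENNReal.ofReal_add (by positivity) (by positivity), dist_eq_norm]
    exact ENNReal.ofReal_le_ofReal ((norm_sub_le _ _).trans (by linarith))
  have hle : dist x ξ ≤ dist x η := by
    by_contra! hlt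
    exact hη1 (hf.eq_one hξ hlt hx' hd'')
  rw [mem_closedBall_zero_iff]
  rw [dist_eq_norm, dist_eq_norm] at hle
  have h1 : ‖ξ‖ ≤ ‖x‖ + ‖x - ξ‖ := by
    simpa using norm_sub_le x (x - ξ)
  linarith [norm_sub_le x η]

theorem iUnion_siteTerritory_subset {r : ℕ} {B : Set (Space d)}
    (hB : B ⊆ Metric.closedBall 0 r) :
    ⋃ x ∈ B, siteTerritory f x ⊆ {ξ | ‖ξ‖ₑ ≤ reach f ξ + r} := by
  refine Set.iUnion₂_subset fun x hx ξ hξ => ?_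
  have hxr : ‖x‖ₑ ≤ r := by
    rw [← ofReal_norm, ← ENNReal.ofReal_natCast]
    exact ENNReal.ofReal_le_ofReal (mem_closedBall_zero_iff.1 (hB hx))
  have h1 : ‖ξ‖ₑ ≤ edist x ξ + ‖x‖ₑ := by
    rw [← edist_zero_right, ← edist_zero_right, edist_comm x ξ]
    exact edist_triangle _ _ _
  exact h1.trans (add_le_add (edist_le_reach hξ) hxr)

end Reach

/-! ### Measurable reach and the almost sure statements -/

section Random

open scoped ProbabilityTheory

variable {Ω : Type*} [MeasurableSpace Ω] {θ : Space d → Ω → Ω} {P : Measure Ω}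
  {Φ Ψ : Ω → Measure (Space d)} {F : Ω → Space d → Space d → ℝ}

/-- Reindexing the supremum by the translation x ↦ x + ξ makes the reach a mark carried along by the
flow. -/
theorem IsFlowAdaptedFunction.reach_eq (hF : IsFlowAdaptedFunction θ F) (ω : Ω) (ξ : Space d) :
    reach (F ω) ξ = reach (F (θ ξ ω)) 0 := by
  rw [reach, reach, ← (Equiv.addRight ξ).iSup_comp]
  refine iSup_congr fun x => ?_
  rw [hF.flowAdapted, zero_add, Equiv.coe_addRight, edist_add_right x 0 ξ |>.symm, zero_add]

/-- Almost surely and `Ψ`-almost everywhere, the reach of a center is a measurable function of the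
configuration seen from that center. -/
theorem IsFlowAdaptedFunction.exists_measurable_reach [SFinite P] (hF : IsFlowAdaptedFunction θ F)
    (hθ : IsMeasurableFlow θ) (hΨ : IsStationaryRandomMeasure θ P Ψ) :
    ∃ h : Ω → ℝ≥0∞, Measurable h ∧
      ∀ᵐ ω ∂P, ∀ᵐ ξ ∂(Ψ ω), reach (F ω) ξ = h (θ ξ ω) := by
  classical
  have := hΨ.isSFiniteKernel
  have hg : Measurable fun p : Ω × Space d => if 0 < F p.1 p.2 0 then edist p.2 0 else 0 := by
    refine Measurable.ite (measurableSet_lt measurable_const ?_) (by fun_prop) measurable_const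
    exact hF.measurable.comp
      (measurable_fst.prodMk (measurable_snd.prodMk measurable_const))
  -- The measure is the image of P ⊗ Ψ under (ω, ξ) ↦ θ_ξ ω, so that its null sets pull back to what
  -- is negligible for almost every ω and Ψ ω-almost every ξ.
  have hae : AEMeasurable (fun ω => reach (F ω) 0)
      ((P ⊗ₘ hΨ.kernel).map fun p => θ p.2 p.1) :=
    hg.aemeasurable_iSup_of_standardBorel _
  refine ⟨hae.mk _, hae.measurable_mk, ?_⟩
  have h1 := ae_of_ae_map hθ.measurable.aemeasurable hae.ae_eq_mk
  filter_upwards [Measure.ae_ae_of_ae_compProd h1] with ω hω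
  rw [hΨ.kernel_apply] at hω
  filter_upwards [hω] with ξ hξ
  rw [hF.reach_eq, hξ]

/-- Boundedness of the territories of almost all centers, and finiteness of the mass claimed by the
sites of a bounded set. -/
theorem ae_isBounded_centerTerritory_and_measure_lt_top [IsFiniteMeasure P]
    (hθ : IsMeasurableFlow θ) (hΨ : IsStationaryRandomMeasure θ P Ψ)
    (hF : IsFlowAdaptedFunction θ F)
    (hFs : ∀ᵐ ω ∂P, IsStableConstrainedDensity (Φ ω) (Ψ ω) (F ω)) :
    ∀ᵐ ω ∂P, (∀ᵐ ξ ∂(Ψ ω), Bornology.IsBounded (centerTerritory (F ω) ξ)) ∧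
      ∀ B : Set (Space d), Bornology.IsBounded B →
        Ψ ω (⋃ x ∈ B, siteTerritory (F ω) x) < ∞ := by
  obtain ⟨h, hh, hreach⟩ := hF.exists_measurable_reach hθ hΨ
  have horth : ∀ᵐ ω ∂P, 0 < d → Ψ ω {ξ | h (θ ξ ω) = ∞} ≠ 0 → ∀ (ε : Fin d → Bool) (m : ℕ),
      Ψ ω {ξ | h (θ ξ ω) = ∞ ∧ ∀ i, m < signVector ε i * ξ i} = ∞ := by
    by_cases hd : 0 < d
    · filter_upwards [hΨ.ae_orthant_eq_top hθ hd hh] with ω hω _ using hω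
    · exact .of_forall fun ω hd' => absurd hd' hd
  filter_upwards [hFs, hreach, horth, hΨ.ae_covering_eq_top hθ hh] with ω hf hρ ho hc
  have := hΨ.locallyFinite ω
  have hcongr : ∀ p : ℝ≥0∞ → Space d → Prop,
      Ψ ω {ξ | p (reach (F ω) ξ) ξ} = Ψ ω {ξ | p (h (θ ξ ω)) ξ} := by
    intro p
    refine measure_congr ?_
    filter_upwards [hρ] with ξ hξ
    change p (reach (F ω) ξ) ξ = p (h (θ ξ ω)) ξ
    rw [hξ]
  constructor
  · rcases Nat.eq_zero_or_pos d with rfl | hd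
    · exact .of_forall fun ξ => Bornology.IsBounded.all _
    have hnull : Ψ ω {ξ | reach (F ω) ξ = ∞} = 0 := by
      by_contra hne
      obtain ⟨ξ, hξ⟩ := nonempty_of_measure_ne_zero hne
      obtain ⟨ε, m, hεm⟩ := hf.exists_orthant_measure_le_one hξ
      rw [hcongr fun a _ => a = ∞] at hne
      rw [hcongr fun a η => a = ∞ ∧ ∀ i, m < signVector ε i * η i, ho hd hne ε m] at hεm
      simp at hεm
    have hae : ∀ᵐ ξ ∂(Ψ ω), ¬ reach (F ω) ξ = ∞ := by
      rw [ae_iff]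
      simpa using hnull
    filter_upwards [hae] with ξ hξ using isBounded_centerTerritory hξ
  · intro B hB
    obtain ⟨R, hR⟩ := hB.subset_closedBall 0
    obtain ⟨r, hr⟩ := exists_nat_ge R
    have hBr : B ⊆ Metric.closedBall 0 (r : ℝ) := hR.trans (Metric.closedBall_subset_closedBall hr)
    -- Either the set containing all claimed centers has finite mass, or the claimed set is bounded.
    by_cases hfin : Ψ ω {ξ | ‖ξ‖ₑ ≤ h (θ ξ ω) + r} = ∞
    · refine (hf.isBounded_iUnion_siteTerritory (r := r) ?_ hBr).measure_lt_top
      rw [hcongr fun a ξ => ‖ξ‖ₑ + r < a, hc r hfin r]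
      exact ENNReal.one_lt_top
    · refine (measure_mono (iUnion_siteTerritory_subset hBr)).trans_lt ?_
      rw [hcongr fun a ξ => ‖ξ‖ₑ ≤ a + r]
      exact lt_top_iff_ne_top.2 hfin

theorem IsFlowAdaptedFunction.swap (hF : IsFlowAdaptedFunction θ F) :
    IsFlowAdaptedFunction θ fun ω x ξ => F ω ξ x where
  measurable := hF.measurable.comp
    (measurable_fst.prodMk (measurable_snd.snd.prodMk measurable_snd.fst))
  flowAdapted s ω x ξ := hF.flowAdapted s ω ξ x

theorem IsStableConstrainedDensity.swap {φ ψ : Measure (Space d)} {f : Space d → Space d → ℝ}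
    (hf : IsStableConstrainedDensity φ ψ f) :
    IsStableConstrainedDensity ψ φ fun x ξ => f ξ x where
  constrained :=
    { measurable := hf.constrained.measurable.comp measurable_swap
      nonneg := fun x ξ => hf.constrained.nonneg ξ x
      le_one := fun x ξ => hf.constrained.le_one ξ x
      site_le := hf.constrained.center_le
      center_le := hf.constrained.site_le }
  stable := by
    rintro x₀ ξ₀ ⟨⟨h1, h2⟩, -, h3⟩
    refine hf.stable ξ₀ x₀ ⟨⟨h1, h3.imp id ?_⟩, h1, h2.imp id ?_⟩
    · rintro ⟨x₁, hd, hx⟩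
      exact ⟨x₁, by rwa [dist_comm, dist_comm ξ₀ x₁], hx⟩
    · rintro ⟨ξ₁, hd, hx⟩
      exact ⟨ξ₁, by rwa [dist_comm, dist_comm ξ₁ x₀], hx⟩

end Random

end StableDensity

/-- Boundedness of territories. The unions in the last two clauses run over all points of the
bounded set `B`, as in the definition of stability, hence in particular over those in the support
of `Φ ω` (the sites), resp. of `Ψ ω` (the centers). -/
theorem theorem3p19 {d : ℕ} {Ω : Type*} [MeasurableSpace Ω]
    (θ : StableDensity.Space d → Ω → Ω) (hθ : StableDensity.IsMeasurableFlow θ)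
    (P : Measure Ω) [IsProbabilityMeasure P]
    (Φ Ψ : Ω → Measure (StableDensity.Space d))
    (hΦ : StableDensity.IsStationaryRandomMeasure θ P Φ)
    (hΨ : StableDensity.IsStationaryRandomMeasure θ P Ψ)
    (hΦ0 : ∀ᵐ ω ∂P, Φ ω ≠ 0) (hΨ0 : ∀ᵐ ω ∂P, Ψ ω ≠ 0)
    (lamΦ lamΨ : ℝ≥0) (hlamΦ : StableDensity.HasIntensity P Φ lamΦ)
    (hlamΨ : StableDensity.HasIntensity P Ψ lamΨ)
    (F : Ω → StableDensity.Space d → StableDensity.Space d → ℝ)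
    (hF : StableDensity.IsFlowAdaptedFunction θ F)
    (hFs : ∀ᵐ ω ∂P, StableDensity.IsStableConstrainedDensity (Φ ω) (Ψ ω) (F ω)) :
    ∀ᵐ ω ∂P,
      (∀ᵐ x ∂(Φ ω), Bornology.IsBounded (StableDensity.siteTerritory (F ω) x)) ∧
      (∀ᵐ ξ ∂(Ψ ω), Bornology.IsBounded (StableDensity.centerTerritory (F ω) ξ)) ∧
      (∀ B : Set (StableDensity.Space d), Bornology.IsBounded B →
        Ψ ω (⋃ x ∈ B, StableDensity.siteTerritory (F ω) x) < ∞) ∧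
      (∀ B : Set (StableDensity.Space d), Bornology.IsBounded B →
        Φ ω (⋃ ξ ∈ B, StableDensity.centerTerritory (F ω) ξ) < ∞) := by
  filter_upwards [
    StableDensity.ae_isBounded_centerTerritory_and_measure_lt_top hθ hΨ hF hFs,
    StableDensity.ae_isBounded_centerTerritory_and_measure_lt_top (Φ := Ψ) hθ hΦ hF.swap
      (hFs.mono fun _ h => h.swap)] with ω hω hω'
  exact ⟨hω'.1, hω.1, hω.2, hω'.2⟩
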